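/- Let $l,m,n_1,\dots,n_l$ be natural numbers. For $i=1,\dots,l$ let $X_i\subseteq\mathbb R^{n_i}$ be convex and closed, $X=X_1\times\dots\times X_l$, let $f_i:X\to\mathbb R$ be continuous and concave in its $i$-th variable $x_i\in X_i$ (the other variables being fixed), and let $h_i=(h_{i1},\dots,h_{im}):\mathbb R^{n_i}\to\mathbb R^m$ have convex components. Let $b\in\mathbb R^m$ and assume that $$D=\Big\{x\in X \;\Big|\; \sum_{i=1}^l h_i(x_i)\le b\Big\}$$ is nonempty (vector inequalities are componentwise). Put $$\Phi(x,y)=\sum_{i=1}^l \big[f_i(x)-f_i(x_{-i},y_i)\big],\qquad x,y\in X,$$ where $(x_{-i},y_i)$ is $x$ with its $i$-th component replaced by $y_i$. The normalized equilibrium problem is to find $$x^*\in D\ \text{ such that }\ \Phi(x^*,y)\ge 0\quad\forall y\in D. \tag{2.1}$$ Let $U_0\subseteq(\mathbb R^{m})^l$ and $U=\{u\in U_0 \mid \sum_{i=1}^l u_i=b\}$. Assume that $U$ is convex, closed and bounded and that for each $x\in D$ there is $u\in U$ with $h_i(x_i)\le u_i$ for all $i$. Let $\varphi:\mathbb R^m\to\mathbb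 R$ be convex, differentiable and isotone ($u\ge v$ implies $\varphi(u)\ge\varphi(v)$), with $\varphi(v)=0$ if $v\le 0$ and $\varphi(v)>0$ otherwise, and put $P(x,u)=\sum_{i=1}^l\varphi(h_i(x_i)-u_i)$. For $\tau>0$ the penalized problem is to find $$w(\tau)=(x(\tau),u(\tau))\in X\times U\ \text{ such that }\ \Phi(x(\tau),x)+\tau\,[P(w)-P(w(\tau))]\ge 0\quad\forall w=(x,u)\in X\times U. \tag{3.1}$$ Let $\mu:X\to\mathbb R$ be lower semicontinuous and convex, and write $B_\rho=\{x\in X\mid \mu(x)\le\rho\}$. Assume that $B_\rho$ is nonempty and bounded for some $\rho\in\mathbb R$, and let $r\in\mathbb R$ be such that for every $x\in X\setminus B_r$ there is $z\in D$ with $\mu(z)\le\mu(x)$ and $\Phi(x,z)<0$. Finally let $(\tau_k)$ be a nondecreasing sequence of positive numbers with $\tau_k\to+\infty$. Then: (i) problem (2.1) has a solution; (ii) for each $\tau>0$ problem (3.1) has a solution, and all its solutions belong to $B_r\times U$; (iii) each sequence $(w(\tau_k))$, where $w(\tau_k)$ is a solution of (3.1) with $\tau=\tau_k$, has limit points; every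 limit point $(\bar x,\bar u)$ belongs to $(B_r\cap D)\times U$, and $\bar x$ solves (2.1). -/

import Mathlib

/-- The data of a generalized noncooperative game with `l` players and `m` joint constraints.
Player `i` chooses a strategy in `X i ⊆ ℝ^{n i}` and has the utility `f i`, of which only the
values on the product of the strategy sets are ever used; the joint constraint is
`∑ i, h i (x i) ≤ b`, componentwise in `ℝ^m`. -/
structure JointGame (l m : ℕ) (n : Fin l → ℕ) where
  /-- strategy sets -/
  X : (i : Fin l) → Set (Fin (n i) → ℝ)
  /-- utility functions -/
  f : Fin l → ((i : Fin l) → Fin (n i) → ℝ) → ℝ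
  /-- constraint functions -/
  h : (i : Fin l) → (Fin (n i) → ℝ) → (Fin m → ℝ)
  /-- right-hand side of the joint constraint -/
  b : Fin m → ℝ

/-- Strategy profiles `x = (x_1, …, x_l)`. -/
abbrev Profile {l : ℕ} (n : Fin l → ℕ) : Type := (i : Fin l) → Fin (n i) → ℝ

/-- Share allocations `u = (u_1, …, u_l)` with `u_i ∈ ℝ^m`. -/
abbrev Shares (l m : ℕ) : Type := Fin l → Fin m → ℝ

namespace JointGame

variable {l m : ℕ} {n : Fin l → ℕ}

/-- The product `X = X_1 × ⋯ × X_l`. -/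
def prodX (G : JointGame l m n) : Set (Profile n) := {x | ∀ i, x i ∈ G.X i}

/-- The joint constraint set `Y`. -/
def jointY (G : JointGame l m n) : Set (Profile n) := {x | ∑ i, G.h i (x i) ≤ G.b}

/-- The common feasible set `D = X ∩ Y`. -/
def feasible (G : JointGame l m n) : Set (Profile n) := G.prodX ∩ G.jointY

/-- `Ψ(x, y) = ∑ i, f_i(x_{-i}, y_i)`. -/
def Psi (G : JointGame l m n) (x y : Profile n) : ℝ :=
  ∑ i, G.f i (Function.update x i (y i))

/-- The Nikaido–Isoda bifunction `Φ(x, y) = Ψ(x, x) - Ψ(x, y)`. -/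
def Phi (G : JointGame l m n) (x y : Profile n) : ℝ := G.Psi x x - G.Psi x y

/-- The basic assumptions on the game. -/
structure BasicAssumptions (G : JointGame l m n) : Prop where
  convex_X : ∀ i, Convex ℝ (G.X i)
  closed_X : ∀ i, IsClosed (G.X i)
  concave_f : ∀ i, ∀ x ∈ G.prodX, ConcaveOn ℝ (G.X i) fun y => G.f i (Function.update x i y)
  continuous_f : ∀ i, ContinuousOn (G.f i) G.prodX
  convex_h : ∀ i j, ConvexOn ℝ Set.univ fun y => G.h i y j
  feasible_nonempty : G.feasible.Nonempty

/-- `x` is a normalized equilibrium point. -/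
def IsNormalizedEquilibrium (G : JointGame l m n) (x : Profile n) : Prop :=
  x ∈ G.feasible ∧ ∀ y ∈ G.feasible, 0 ≤ G.Phi x y

/-- The level set `B_r = {x ∈ X | μ x ≤ r}`. -/
def levelSet (G : JointGame l m n) (μ : Profile n → ℝ) (r : ℝ) : Set (Profile n) :=
  {x | x ∈ G.prodX ∧ μ x ≤ r}

/-- `μ` is weakly coercive with respect to `X`: some level set is nonempty and bounded. -/
def WeaklyCoercive (G : JointGame l m n) (μ : Profile n → ℝ) : Prop :=
  ∃ ρ : ℝ, (G.levelSet μ ρ).Nonempty ∧ Bornology.IsBounded (G.levelSet μ ρ)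

/-- The coercivity condition, for a given function `μ` on `X` and a given number `r`
(which need not be the level witnessing weak coercivity). -/
structure Coercivity (G : JointGame l m n) (μ : Profile n → ℝ) (r : ℝ) : Prop where
  lsc : LowerSemicontinuousOn μ G.prodX
  convex : ConvexOn ℝ G.prodX μ
  weaklyCoercive : G.WeaklyCoercive μ
  descent : ∀ x ∈ G.prodX \ G.levelSet μ r, ∃ z ∈ G.feasible, μ z ≤ μ x ∧ G.Phi x z < 0

/-- The set `U` of feasible partitions of `b` subject to the additional restrictions `U₀`. -/
def shareSet (G : JointGame l m n) (U₀ : Set (Shares l m)) : Set (Shares l m) :=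
  {u | u ∈ U₀ ∧ ∑ i, u i = G.b}

/-- The standing requirements on the feasible partitions: `U` is convex and closed, and every
jointly feasible profile is supported by some partition in `U`. -/
structure AdmissibleShares (G : JointGame l m n) (U₀ : Set (Shares l m)) : Prop where
  convex : Convex ℝ (G.shareSet U₀)
  closed : IsClosed (G.shareSet U₀)
  covers : ∀ x ∈ G.feasible, ∃ u ∈ G.shareSet U₀, ∀ i, G.h i (x i) ≤ u i

/-- The penalty `P(x, u) = ∑ i, φ(h_i(x_i) - u_i)`. -/
def penalty (G : JointGame l m n) (φ : (Fin m → ℝ) → ℝ) (w : Profile n × Shares l m) : ℝ :=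
  ∑ i, φ (G.h i (w.1 i) - w.2 i)

/-- `Φ_τ(w, w') = Φ(x, x') + τ (P(w') - P(w))` for `w = (x, u)`, `w' = (x', u')`. -/
def penPhi (G : JointGame l m n) (φ : (Fin m → ℝ) → ℝ) (τ : ℝ)
    (w w' : Profile n × Shares l m) : ℝ :=
  G.Phi w.1 w'.1 + τ * (G.penalty φ w' - G.penalty φ w)

/-- `w` solves the penalized equilibrium problem on `X × U` with parameter `τ`. -/
def IsPenalizedSolution (G : JointGame l m n) (U₀ : Set (Shares l m))
    (φ : (Fin m → ℝ) → ℝ) (τ : ℝ) (w : Profile n × Shares l m) : Prop :=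
  w ∈ G.prodX ×ˢ G.shareSet U₀ ∧ ∀ w' ∈ G.prodX ×ˢ G.shareSet U₀, 0 ≤ G.penPhi φ τ w w'

end JointGame

/-- Convex differentiable isotone functions vanishing exactly on the nonpositive orthant and
positive elsewhere. -/
structure IsPenaltyKernel {m : ℕ} (φ : (Fin m → ℝ) → ℝ) : Prop where
  convex : ConvexOn ℝ Set.univ φ
  differentiable : Differentiable ℝ φ
  isotone : Monotone φ
  eq_zero : ∀ v, v ≤ 0 → φ v = 0
  pos : ∀ v, ¬ v ≤ 0 → 0 < φ v

/-! A jointly feasible `y` can be paired with shares of zero penalty. Testing a penalized solution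
`w` against that pair gives `t * P(w) ≤ Φ(w.1, y)` (`penalty_le_Phi`), and everything about the
limit follows from this. Since `Φ(·, y)` converges along a convergent subsequence while `τ k → ∞`,
the penalty vanishes at a limit point. The limit is then feasible because its shares sum to `b`, and
`0 ≤ Φ(·, y)` passes to the limit.

Compactness comes from coercivity. One bounded nonempty level set of a convex lsc `μ` makes all of
them bounded, and the descent condition forces penalized solutions into `B_r`. They exist by Ky
Fan's inequality on a compact piece `B_ρ × U` with `ρ > r`. There the constraint `μ ≤ ρ` is inactive
at the solution, so by convexity it solves the full problem. The equilibrium in (i) is a limit point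
of such solutions.

Ky Fan's inequality is derived from Brouwer's theorem, and Brouwer's theorem from the absence of a
`C¹` retraction onto the sphere. The latter is a volume argument: the integral over the ball of the
Jacobian of `x + t (f x - x)` is polynomial in `t`, equal to the volume for small `t > 0` and to
zero at `t = 1`. -/

/-! ### Determinants of perturbed identities, and metric projection. -/

theorem LinearMap.exists_polynomial_det_one_add_smul {E : Type*} [AddCommGroup E] [Module ℝ E]
    [FiniteDimensional ℝ E] (A : E →ₗ[ℝ] E) :
    ∃ p : Polynomial ℝ, p.natDegree ≤ Module.finrank ℝ E ∧
      ∀ t : ℝ, p.eval t = LinearMap.det (1 + t • A) := by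
  let b := Module.finBasis ℝ E
  let M := LinearMap.toMatrix b b A
  refine ⟨Matrix.det ((Polynomial.X : Polynomial ℝ) • M.map Polynomial.C +
    (1 : Matrix _ _ ℝ).map Polynomial.C), ?_, fun t => ?_⟩
  · simpa using Polynomial.natDegree_det_X_add_C_le M 1
  · rw [← Polynomial.coe_evalRingHom, RingHom.map_det, ← LinearMap.det_toMatrix b]
    congr 1
    ext i j
    simp [M, Matrix.one_apply, LinearMap.toMatrix_one, apply_ite, add_comm]
    split_ifs <;> simp [mul_comm]

/-- The degree bound is uniform in `x`, so Lagrange interpolation at the nodes `0, …, finrank`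
writes each determinant as a combination of its values there, with weights depending on `t` alone.
Integrability of the individual coefficients is never needed. -/
theorem ContinuousLinearMap.exists_polynomial_integral_det_one_add_smul
    {E α : Type*} [NormedAddCommGroup E] [NormedSpace ℝ E] [FiniteDimensional ℝ E]
    [MeasurableSpace α] {ν : MeasureTheory.Measure α} (A : α → E →L[ℝ] E)
    (hA : ∀ t : ℝ, MeasureTheory.Integrable (fun x => (1 + t • A x).det) ν) :
    ∃ p : Polynomial ℝ, ∀ t : ℝ, p.eval t = ∫ x, (1 + t • A x).det ∂ν := by
  let s := Finset.range (Module.finrank ℝ E + 1)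
  let v : ℕ → ℝ := fun i => i
  have hv : Set.InjOn v s := fun i _ j _ h => by simpa [v] using h
  refine ⟨∑ i ∈ s, Polynomial.C (∫ x, (1 + v i • A x).det ∂ν) * Lagrange.basis s v i,
    fun t => ?_⟩
  have key : ∀ x, (1 + t • A x).det =
      ∑ i ∈ s, (1 + v i • A x).det * (Lagrange.basis s v i).eval t := by
    intro x
    obtain ⟨p, hd, hp⟩ := LinearMap.exists_polynomial_det_one_add_smul (A x : E →ₗ[ℝ] E)
    have hp' : ∀ t, p.eval t = (1 + t • A x).det := hp
    have hdeg : p.degree < s.card := by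
      rw [Finset.card_range]
      exact (Polynomial.degree_le_natDegree).trans_lt (by exact_mod_cast Nat.lt_succ_of_le hd)
    have := congrArg (Polynomial.eval t) (Lagrange.eq_interpolate hv hdeg)
    rw [hp', Lagrange.interpolate_apply, Polynomial.eval_finsetSum] at this
    rw [this]
    simp [hp']
  simp_rw [key]
  rw [MeasureTheory.integral_finsetSum _ fun i _ => (hA _).mul_const _, Polynomial.eval_finsetSum]
  simp [MeasureTheory.integral_mul_const]

/-- No operator on the segment from `1` to `1 + A` is singular, since a kernel vector would satisfy
`‖v‖ ≤ ‖A‖ ‖v‖`. The determinant therefore keeps the sign it has at `1`. -/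
theorem ContinuousLinearMap.det_one_add_pos {E : Type*} [NormedAddCommGroup E] [NormedSpace ℝ E]
    [FiniteDimensional ℝ E] {A : E →L[ℝ] E} (hA : ‖A‖ < 1) : 0 < (1 + A).det := by
  have hne : ∀ s ∈ Set.Icc (0 : ℝ) 1, (1 + s • A).det ≠ 0 := by
    intro s hs h0
    have hker : ¬ LinearMap.ker ((1 + s • A : E →L[ℝ] E) : E →ₗ[ℝ] E) = ⊥ := by
      intro hb
      exact ((LinearMap.isUnit_iff_ker_eq_bot _).2 hb).map LinearMap.det |>.ne_zero h0
    obtain ⟨v, hv, hv0⟩ := Submodule.exists_mem_ne_zero_of_ne_bot hker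
    have hv' : v + s • A v = 0 := by simpa using hv
    have h1 : ‖v‖ = ‖s • A v‖ := by
      rw [← norm_neg (s • A v), ← eq_neg_of_add_eq_zero_left hv']
    have h2 : ‖s • A v‖ ≤ ‖A‖ * ‖v‖ := by
      rw [norm_smul, Real.norm_of_nonneg hs.1]
      calc s * ‖A v‖ ≤ 1 * ‖A v‖ := by gcongr; exact hs.2
        _ ≤ ‖A‖ * ‖v‖ := by rw [one_mul]; exact A.le_opNorm v
    have h3 : 0 < ‖v‖ := norm_pos_iff.2 hv0
    nlinarith
  by_contra hneg
  have hcont : ContinuousOn (fun s : ℝ => (1 + s • A).det) (Set.Icc 0 1) :=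
    (ContinuousLinearMap.continuous_det.comp (by fun_prop)).continuousOn
  have := intermediate_value_Icc' zero_le_one hcont
  obtain ⟨s, hs, h0⟩ := this (show (0 : ℝ) ∈ _ from
    ⟨by simpa using not_lt.1 hneg, by simp [ContinuousLinearMap.det]⟩)
  exact hne s hs h0

/-- The metric projection onto a nonempty complete convex set. -/
theorem Convex.exists_lipschitzWith_projection {E : Type*} [NormedAddCommGroup E]
    [InnerProductSpace ℝ E] {K : Set E} (hne : K.Nonempty) (hK : IsComplete K)
    (hconv : Convex ℝ K) :
    ∃ p : E → E, LipschitzWith 1 p ∧ (∀ x, p x ∈ K) ∧ (∀ x ∈ K, p x = x) ∧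
      ∀ x, ∀ w ∈ K, inner ℝ (x - p x) (w - p x) ≤ 0 := by
  choose p hp hmin using exists_norm_eq_iInf_of_complete_convex hne hK hconv
  have hin : ∀ x, ∀ w ∈ K, inner ℝ (x - p x) (w - p x) ≤ 0 := fun x =>
    (norm_eq_iInf_iff_real_inner_le_zero hconv (hp x)).1 (hmin x)
  refine ⟨p, LipschitzWith.of_dist_le_mul fun x y => ?_, hp, fun x hx => ?_, hin⟩
  · have h1 := hin x (p y) (hp y)
    have h2 := hin y (p x) (hp x)
    have h3 : ‖p x - p y‖ ^ 2 ≤ inner ℝ (x - y) (p x - p y) := by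
      rw [← real_inner_self_eq_norm_sq]
      simp only [inner_sub_left, inner_sub_right] at *
      linarith
    have h4 := real_inner_le_norm (x - y) (p x - p y)
    rw [dist_eq_norm, dist_eq_norm, NNReal.coe_one, one_mul]
    by_contra! hlt
    have := norm_nonneg (x - y)
    nlinarith
  · have := hin x x hx
    rw [real_inner_self_eq_norm_sq] at this
    have h0 : ‖x - p x‖ = 0 := by nlinarith [norm_nonneg (x - p x)]
    exact (sub_eq_zero.1 (norm_eq_zero.1 h0)).symm

/-! ### Nonexistence of a `C¹` retraction onto the sphere. -/

section NoRetraction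

variable {E : Type*} [NormedAddCommGroup E] [InnerProductSpace ℝ E] [FiniteDimensional ℝ E]

/-- A map that is Lipschitz on the closed unit ball and vanishes on the unit sphere agrees on the
ball with a Lipschitz map vanishing off the open ball. -/
theorem exists_lipschitzWith_extension_of_eq_zero_on_sphere {g : E → E} {C : NNReal}
    (hg : LipschitzOnWith C g (Metric.closedBall 0 1)) (h0 : ∀ x, ‖x‖ = 1 → g x = 0) :
    ∃ G : E → E, LipschitzWith C G ∧ Set.EqOn G g (Metric.closedBall 0 1) ∧
      ∀ x ∉ Metric.ball (0 : E) 1, G x = 0 := by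
  obtain ⟨p, hp, hmem, hfix, hin⟩ := Convex.exists_lipschitzWith_projection (E := E)
    (K := Metric.closedBall 0 1) ⟨0, by simp⟩ Metric.isClosed_closedBall.isComplete
    (convex_closedBall 0 1)
  refine ⟨g ∘ p, ?_, fun x hx => by simp [hfix x hx], fun x hx => ?_⟩
  · rw [← lipschitzOnWith_univ] at hp ⊢
    simpa using hg.comp hp (fun x _ => hmem x)
  · apply h0
    have hle : ‖p x‖ ≤ 1 := by simpa using hmem x
    by_contra hne
    have hlt : ‖p x‖ < 1 := lt_of_le_of_ne hle hne
    have hx1 : 1 ≤ ‖x‖ := by simpa using hx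
    have hd : 0 < ‖x - p x‖ := by
      rw [norm_pos_iff, sub_ne_zero]; rintro h; rw [← h] at hlt; linarith
    -- If `p x` were interior, a step of this size towards `x` would stay in the ball and violate
    -- the variational inequality of the projection.
    let ε := (1 - ‖p x‖) / ‖x - p x‖
    have hε : 0 < ε := div_pos (by linarith) hd
    have hw : p x + ε • (x - p x) ∈ Metric.closedBall (0 : E) 1 := by
      rw [mem_closedBall_zero_iff]
      calc _ ≤ ‖p x‖ + ‖ε • (x - p x)‖ := norm_add_le _ _
        _ = 1 := by
          rw [norm_smul, Real.norm_of_nonneg hε.le, div_mul_cancel₀ _ hd.ne']; ring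
    have := hin x _ hw
    rw [add_sub_cancel_left, inner_smul_right, real_inner_self_eq_norm_sq] at this
    have : 0 < ε * ‖x - p x‖ ^ 2 := by positivity
    linarith

/-- A contractive perturbation of the identity is a bijection of the space; being the identity off
the ball, it must permute the ball. -/
theorem image_ball_eq_of_lipschitzWith_lt_one {G : E → E} {c : NNReal} (hc : c < 1)
    (hG : LipschitzWith c G) (h0 : ∀ x ∉ Metric.ball (0 : E) 1, G x = 0) :
    Function.Injective (fun x => x + G x) ∧
      (fun x => x + G x) '' Metric.ball 0 1 = Metric.ball 0 1 := by
  have happ : ApproximatesLinearOn (fun x => x + G x)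
      ((ContinuousLinearEquiv.refl ℝ E : E ≃L[ℝ] E) : E →L[ℝ] E) Set.univ c := by
    intro x _ y _
    simpa [dist_eq_norm, add_sub_add_comm] using hG.dist_le_mul x y
  have hc' : Subsingleton E ∨ c < ‖((ContinuousLinearEquiv.refl ℝ E).symm : E →L[ℝ] E)‖₊⁻¹ := by
    rcases subsingleton_or_nontrivial E with h | h
    · exact Or.inl h
    · right
      have : ‖((ContinuousLinearEquiv.refl ℝ E).symm : E →L[ℝ] E)‖₊ = 1 :=
        NNReal.eq (ContinuousLinearMap.norm_id)
      rw [this]; simpa using hc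
  have hinj : Function.Injective (fun x => x + G x) :=
    Set.injOn_univ.1 (happ.injOn hc')
  have hsurj := happ.surjective hc'
  refine ⟨hinj, Set.Subset.antisymm ?_ ?_⟩
  · rintro _ ⟨x, hx, rfl⟩
    by_contra hn
    have hfix : (x + G x) + G (x + G x) = x + G x := by rw [h0 _ hn, add_zero]
    have : x + G x = x := hinj hfix
    exact hn (by simpa [this] using hx)
  · intro y hy
    obtain ⟨x, rfl⟩ := hsurj y
    refine ⟨x, ?_, rfl⟩
    by_contra hn
    simp only [h0 x hn, add_zero] at hy
    exact hn hy

/-- Differentiating `‖f‖ ^ 2 = 1` shows that the range of the derivative is orthogonal to the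
nonzero vector `f x`. -/
theorem det_fderiv_eq_zero_of_norm_eq_one {f : E → E} {x : E} (hf : DifferentiableAt ℝ f x)
    (h1 : ∀ᶠ y in nhds x, ‖f y‖ = 1) : (fderiv ℝ f x).det = 0 := by
  by_contra hne
  have hsurj : Function.Surjective (fderiv ℝ f x) := by
    have hu : IsUnit ((fderiv ℝ f x : E →L[ℝ] E) : E →ₗ[ℝ] E) :=
      (LinearMap.isUnit_iff_isUnit_det _).2 (isUnit_iff_ne_zero.2 hne)
    exact ((Module.End.isUnit_iff _).1 hu).2
  obtain ⟨v, hv⟩ := hsurj (f x)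
  have hd : HasFDerivAt (fun y => ‖f y‖ ^ 2) (2 • (innerSL ℝ (f x)).comp (fderiv ℝ f x)) x :=
    hf.hasFDerivAt.norm_sq
  have hc : HasFDerivAt (fun y => ‖f y‖ ^ 2) (0 : E →L[ℝ] ℝ) x :=
    (hasFDerivAt_const (1 : ℝ) x).congr_of_eventuallyEq (h1.mono fun y hy => by simp [hy])
  have := congrArg (fun L : E →L[ℝ] ℝ => L v) (hd.unique hc)
  simp [hv, h1.self_of_nhds] at this

/-- There is no `C¹` retraction of the closed unit ball onto the unit sphere. -/
theorem no_contDiff_retraction_unitSphere {f : E → E}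
    (hf : ∀ x ∈ Metric.closedBall (0 : E) 1, ContDiffAt ℝ 1 f x)
    (hfix : ∀ x, ‖x‖ = 1 → f x = x) (hnorm : ∀ x ∈ Metric.closedBall (0 : E) 1, ‖f x‖ = 1) :
    False := by
  borelize E
  set B := Metric.ball (0 : E) 1
  set D := Metric.closedBall (0 : E) 1
  have hBD : B ⊆ D := Metric.ball_subset_closedBall
  let g : E → E := fun x => f x - x
  have hgC : ∀ x ∈ D, ContDiffAt ℝ 1 g x := fun x hx => (hf x hx).sub contDiffAt_id
  have hgd : ∀ x ∈ D, DifferentiableAt ℝ g x := fun x hx => (hgC x hx).differentiableAt one_ne_zero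
  have hA : ContinuousOn (fderiv ℝ g) D := fun x hx =>
    ((hgC x hx).continuousAt_fderiv one_ne_zero).continuousWithinAt
  have hD : IsCompact D := isCompact_closedBall 0 1
  obtain ⟨C₀, hC₀⟩ := hD.exists_bound_of_continuousOn hA
  let C : NNReal := Real.toNNReal C₀
  have hC : ∀ x ∈ D, ‖fderiv ℝ g x‖₊ ≤ C := fun x hx => by
    rw [← NNReal.coe_le_coe]; exact (hC₀ x hx).trans (Real.le_coe_toNNReal _)
  have hlip : LipschitzOnWith C g D :=
    (convex_closedBall 0 1).lipschitzOnWith_of_nnnorm_fderiv_le hgd hC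
  obtain ⟨G, hGlip, hGeq, hG0⟩ := exists_lipschitzWith_extension_of_eq_zero_on_sphere hlip
    (fun x hx => by simp [g, hfix x hx])
  let ν : MeasureTheory.Measure E := MeasureTheory.Measure.addHaar
  have hdet : ∀ t : ℝ, ContinuousOn (fun x => (1 + t • fderiv ℝ g x).det) D := fun t =>
    ContinuousLinearMap.continuous_det.comp_continuousOn
      (continuousOn_const.add (hA.const_smul t))
  have hint : ∀ t : ℝ, MeasureTheory.Integrable (fun x => (1 + t • fderiv ℝ g x).det)
      (ν.restrict B) := fun t =>
    ((hdet t).integrableOn_compact hD).mono_set hBD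
  obtain ⟨P, hP⟩ :=
    ContinuousLinearMap.exists_polynomial_integral_det_one_add_smul (fderiv ℝ g) hint
  -- For small `t` the map `x + t • G x` permutes the ball with positive Jacobian, so the change of
  -- variables formula gives the volume. Using `C + 1` keeps the bound on `t` meaningful when `C =
  -- 0`.
  have hsmall : ∀ t : ℝ, 0 < t → t * (C + 1) < 1 → P.eval t = ν.real B := by
    intro t ht htC
    have htC' : t * C < 1 := by nlinarith
    have hlt : Real.toNNReal t * C < 1 := by
      rw [← NNReal.coe_lt_coe]; simpa [ht.le] using htC'
    have hGt : LipschitzWith (Real.toNNReal t * C) (fun x => t • G x) := by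
      refine LipschitzWith.of_dist_le_mul fun x y => ?_
      rw [dist_smul₀, Real.norm_of_nonneg ht.le, NNReal.coe_mul,
        Real.coe_toNNReal _ ht.le, mul_assoc]
      exact mul_le_mul_of_nonneg_left (hGlip.dist_le_mul x y) ht.le
    obtain ⟨hinj, himg⟩ := image_ball_eq_of_lipschitzWith_lt_one hlt hGt
      (fun x hx => by simp [hG0 x hx])
    have hder : ∀ x ∈ B, HasFDerivWithinAt (fun x => x + t • G x) (1 + t • fderiv ℝ g x) B x := by
      intro x hx
      have h1 : HasFDerivAt (fun x => x + t • g x) (1 + t • fderiv ℝ g x) x :=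
        (hasFDerivAt_id x).add ((hgd x (hBD hx)).hasFDerivAt.const_smul t)
      exact h1.hasFDerivWithinAt.congr (fun y hy => by simp [hGeq (hBD hy)])
        (by simp [hGeq (hBD hx)])
    have hvol := MeasureTheory.lintegral_abs_det_fderiv_eq_addHaar_image ν
      Metric.isOpen_ball.measurableSet hder hinj.injOn
    rw [himg] at hvol
    have hpos : ∀ x ∈ B, 0 < (1 + t • fderiv ℝ g x).det := fun x hx => by
      apply ContinuousLinearMap.det_one_add_pos
      rw [norm_smul, Real.norm_of_nonneg ht.le]
      have : ‖fderiv ℝ g x‖ ≤ C := hC x (hBD hx)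
      nlinarith
    rw [hP, MeasureTheory.integral_eq_lintegral_of_nonneg_ae
      ((MeasureTheory.ae_restrict_iff' Metric.isOpen_ball.measurableSet).2
        (Filter.Eventually.of_forall fun x hx => (hpos x hx).le)) (hint t).1,
      MeasureTheory.measureReal_def, ← hvol]
    congr 1
    exact MeasureTheory.setLIntegral_congr_fun Metric.isOpen_ball.measurableSet
      fun x hx => by rw [abs_of_pos (hpos x hx)]
  have hconst : P = Polynomial.C (ν.real B) := by
    apply Polynomial.eq_of_infinite_eval_eq
    apply (Set.Ioo_infinite (a := (0 : ℝ)) (b := 1 / (C + 1)) (by positivity)).mono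
    intro t ht
    simp only [Set.mem_ofPred_eq, Polynomial.eval_C]
    exact hsmall t ht.1 ((lt_div_iff₀ (by positivity)).1 ht.2)
  have h1 : P.eval 1 = 0 := by
    rw [hP]
    refine (MeasureTheory.setIntegral_congr_fun Metric.isOpen_ball.measurableSet
      (g := fun _ => (0 : ℝ)) fun x hx => ?_).trans (by simp)
    have hfd : fderiv ℝ f x = 1 + (1 : ℝ) • fderiv ℝ g x := by
      have hfx : DifferentiableAt ℝ f x := (hf x (hBD hx)).differentiableAt one_ne_zero
      have : fderiv ℝ g x = fderiv ℝ f x - 1 := by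
        rw [show g = fun x => f x - x from rfl, fderiv_fun_sub hfx differentiableAt_fun_id]
        simp [ContinuousLinearMap.one_def]
      rw [this]; simp
    simp only
    rw [← hfd]
    exact det_fderiv_eq_zero_of_norm_eq_one ((hf x (hBD hx)).differentiableAt one_ne_zero)
      (Filter.eventually_of_mem (Metric.isOpen_ball.mem_nhds hx) fun y hy => hnorm y (hBD hy))
  rw [hconst, Polynomial.eval_C] at h1
  have : 0 < ν.real B := ENNReal.toReal_pos
    (Metric.measure_ball_pos ν 0 one_pos).ne' MeasureTheory.measure_ball_lt_top.ne
  linarith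

end NoRetraction

/-! ### Brouwer's fixed point theorem and Ky Fan's inequality. -/

section Brouwer

/-- Without fixed points, sending `x` to the point where the ray from `f x` through `x` leaves the
ball would be a `C¹` retraction onto the sphere. -/
theorem exists_fixedPoint_unitBall_of_contDiff {E : Type*} [NormedAddCommGroup E]
    [InnerProductSpace ℝ E] [FiniteDimensional ℝ E] {f : E → E} (hf : ContDiff ℝ 1 f)
    (hmaps : ∀ x ∈ Metric.closedBall (0 : E) 1, f x ∈ Metric.closedBall (0 : E) 1) :
    ∃ x ∈ Metric.closedBall (0 : E) 1, f x = x := by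
  by_contra! hne
  let u : E → E := fun x => x - f x
  let q : E → ℝ := fun x => inner ℝ x (u x)
  -- `c x` is the larger root `s` of `‖x + s • u x‖ ^ 2 = 1`, and `d x` is a quarter of the
  -- discriminant. Positivity of `d` makes the square root smooth; on the sphere `q > 0`, so the
  -- root is `0`.
  let d : E → ℝ := fun x => q x ^ 2 + ‖u x‖ ^ 2 * (1 - ‖x‖ ^ 2)
  let c : E → ℝ := fun x => (-q x + √(d x)) / ‖u x‖ ^ 2
  have hu : ContDiff ℝ 1 u := contDiff_id.sub hf
  have hq : ContDiff ℝ 1 q := contDiff_id.inner ℝ hu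
  have hun : ContDiff ℝ 1 fun x => ‖u x‖ ^ 2 := hu.norm_sq ℝ
  have hd : ContDiff ℝ 1 d := (hq.pow 2).add (hun.mul (contDiff_const.sub (contDiff_id.norm_sq ℝ)))
  have hu0 : ∀ x ∈ Metric.closedBall (0 : E) 1, 0 < ‖u x‖ ^ 2 := fun x hx => by
    have : u x ≠ 0 := sub_ne_zero.2 (hne x hx).symm
    positivity
  have hq1 : ∀ x, ‖x‖ = 1 → 0 < q x := by
    intro x hx
    have hxm : x ∈ Metric.closedBall (0 : E) 1 := by simp [hx]
    have hfx : ‖f x‖ ≤ 1 := by simpa using hmaps x hxm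
    have h1 : ‖u x‖ ^ 2 = ‖x‖ ^ 2 - 2 * inner ℝ x (f x) + ‖f x‖ ^ 2 := norm_sub_sq_real x (f x)
    have h2 : q x = ‖x‖ ^ 2 - inner ℝ x (f x) := by
      simp [q, u, inner_sub_right]
    have := hu0 x hxm
    have := norm_nonneg (f x)
    nlinarith
  have hd0 : ∀ x ∈ Metric.closedBall (0 : E) 1, 0 < d x := by
    intro x hx
    have hx1 : ‖x‖ ≤ 1 := by simpa using hx
    rcases hx1.lt_or_eq with h | h
    · have h3 : 0 < 1 - ‖x‖ ^ 2 := by nlinarith [norm_nonneg x]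
      have := hu0 x hx
      simp only [d]
      positivity
    · have := hq1 x h
      simp only [d, h]
      nlinarith
  refine no_contDiff_retraction_unitSphere (f := fun x => x + c x • u x) ?_ ?_ ?_
  · intro x hx
    refine contDiffAt_id.add (ContDiffAt.smul (ContDiffAt.div ?_ hun.contDiffAt (hu0 x hx).ne')
      hu.contDiffAt)
    exact hq.contDiffAt.neg.add (hd.contDiffAt.sqrt (hd0 x hx).ne')
  · intro x hx
    have h1 : √(d x) = q x := by
      simp only [d, hx]
      rw [show q x ^ 2 + ‖u x‖ ^ 2 * (1 - 1 ^ 2) = q x ^ 2 by ring, Real.sqrt_sq (hq1 x hx).le]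
    simp [c, h1]
  · intro x hx
    have hux := hu0 x hx
    have hs : √(d x) ^ 2 = d x := Real.sq_sqrt (hd0 x hx).le
    have hc : c x * ‖u x‖ ^ 2 = -q x + √(d x) := div_mul_cancel₀ _ hux.ne'
    have hnorm : ‖x + c x • u x‖ ^ 2 = ‖x‖ ^ 2 + 2 * (c x * q x) + c x ^ 2 * ‖u x‖ ^ 2 := by
      rw [norm_add_sq_real, inner_smul_right, norm_smul, mul_pow, Real.norm_eq_abs, sq_abs]
    have h1 : ‖u x‖ ^ 2 * (‖x + c x • u x‖ ^ 2 - 1) = 0 := by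
      rw [hnorm]
      have : ‖u x‖ ^ 2 * (‖x‖ ^ 2 + 2 * (c x * q x) + c x ^ 2 * ‖u x‖ ^ 2 - 1) =
          ‖u x‖ ^ 2 * (‖x‖ ^ 2 - 1) + 2 * (c x * ‖u x‖ ^ 2) * q x + (c x * ‖u x‖ ^ 2) ^ 2 := by
        ring
      rw [this, hc]
      simp only [d] at hs ⊢
      linear_combination hs
    have h2 : ‖x + c x • u x‖ ^ 2 = 1 := by
      rcases mul_eq_zero.1 h1 with h | h <;> linarith
    exact (pow_eq_one_iff_of_nonneg (norm_nonneg _) two_ne_zero).1 h2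

theorem exists_fixedPoint_unitBall {E : Type*} [NormedAddCommGroup E]
    [InnerProductSpace ℝ E] [FiniteDimensional ℝ E] {f : E → E} (hf : Continuous f)
    (hmaps : ∀ x, f x ∈ Metric.closedBall (0 : E) 1) :
    ∃ x, f x = x := by
  obtain ⟨x₀, hx₀, hmin⟩ := (isCompact_closedBall (0 : E) 1).exists_isMinOn ⟨0, by simp⟩
    (f := fun x => ‖f x - x‖) (by fun_prop)
  refine ⟨x₀, ?_⟩
  by_contra hne
  have hδ : 0 < ‖f x₀ - x₀‖ := norm_pos_iff.2 (sub_ne_zero.2 hne)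
  -- A fixed point of the rescaled approximation `(1 + ε)⁻¹ • g` is moved by `f` less than `2 * ε`,
  -- below the minimal displacement `3 * ε`.
  set ε := ‖f x₀ - x₀‖ / 3 with hε
  have hε0 : 0 < ε := by positivity
  obtain ⟨g, hg, hgf, -⟩ := hf.exists_contDiff_approx 1 (ε := fun _ => ε) continuous_const
    fun _ => hε0
  have hgn : ∀ x, ‖g x‖ ≤ 1 + ε := fun x => by
    have h1 : ‖f x‖ ≤ 1 := by simpa using hmaps x
    have h2 : ‖g x - f x‖ < ε := by simpa [dist_eq_norm] using hgf x
    have h3 : ‖g x‖ ≤ ‖f x‖ + ‖g x - f x‖ := norm_le_norm_add_norm_sub' _ _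
    linarith
  have hg1 : ContDiff ℝ 1 fun x => (1 + ε)⁻¹ • g x := contDiff_const.smul hg
  obtain ⟨x, hx, hfix⟩ := exists_fixedPoint_unitBall_of_contDiff hg1 fun x _ => by
    rw [mem_closedBall_zero_iff, norm_smul, Real.norm_of_nonneg (by positivity),
      inv_mul_le_iff₀ (by positivity)]
    simpa using hgn x
  have hgx : g x = (1 + ε) • x := by
    rw [← inv_smul_eq_iff₀ (by positivity)]; exact hfix
  have h1 : ‖g x - x‖ ≤ ε := by
    rw [hgx, add_smul, one_smul, add_sub_cancel_left, norm_smul, Real.norm_of_nonneg hε0.le]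
    have : ‖x‖ ≤ 1 := by simpa using hx
    nlinarith
  have h2 : ‖f x - g x‖ < ε := by simpa [dist_eq_norm, norm_sub_rev] using hgf x
  have h3 : ‖f x₀ - x₀‖ ≤ ‖f x - x‖ := hmin hx
  have h4 : ‖f x - x‖ ≤ ‖f x - g x‖ + ‖g x - x‖ := norm_sub_le_norm_sub_add_norm_sub _ _ _
  linarith

/-- Precomposing `f` with the projection onto `K` and rescaling reduces to the unit ball. The fixed
point found is a value of `f` on `K`, hence lies in `K`, where the projection is the identity. -/
theorem Convex.exists_fixedPoint_of_isCompact_of_inner {E : Type*} [NormedAddCommGroup E]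
    [InnerProductSpace ℝ E] [FiniteDimensional ℝ E] {K : Set E} (hconv : Convex ℝ K)
    (hK : IsCompact K) (hne : K.Nonempty) {f : E → E} (hf : ContinuousOn f K)
    (hmaps : Set.MapsTo f K K) : ∃ x ∈ K, f x = x := by
  obtain ⟨p, hp, hpK, hfix, -⟩ := hconv.exists_lipschitzWith_projection hne hK.isComplete
  obtain ⟨R, hR0, hR⟩ := hK.isBounded.exists_pos_norm_le
  obtain ⟨x, hx⟩ := exists_fixedPoint_unitBall (f := fun x => R⁻¹ • f (p (R • x)))
    ((hf.comp_continuous (hp.continuous.comp (continuous_const_smul R))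
      fun x => hpK _).const_smul _) fun x => by
    rw [mem_closedBall_zero_iff, norm_smul, Real.norm_of_nonneg (by positivity),
      inv_mul_le_iff₀ hR0]
    simpa using hR _ (hmaps (hpK _))
  have hx' : f (p (R • x)) = R • x := by rwa [inv_smul_eq_iff₀ hR0.ne'] at hx
  have hmem : R • x ∈ K := hx' ▸ hmaps (hpK _)
  exact ⟨R • x, hmem, by rwa [hfix _ hmem] at hx'⟩

/-- **Brouwer's fixed point theorem** for compact convex sets in a finite-dimensional space. -/
theorem Convex.exists_fixedPoint_of_isCompact {E : Type*} [NormedAddCommGroup E]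
    [NormedSpace ℝ E] [FiniteDimensional ℝ E] {K : Set E} (hconv : Convex ℝ K)
    (hK : IsCompact K) (hne : K.Nonempty) {f : E → E} (hf : ContinuousOn f K)
    (hmaps : Set.MapsTo f K K) : ∃ x ∈ K, f x = x := by
  let e : E ≃L[ℝ] EuclideanSpace ℝ (Fin (Module.finrank ℝ E)) := toEuclidean
  have hsymm : Set.MapsTo e.symm (e '' K) K := by
    rintro _ ⟨x, hx, rfl⟩; simpa using hx
  obtain ⟨_, ⟨x, hx, rfl⟩, hfix⟩ := Convex.exists_fixedPoint_of_isCompact_of_inner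
    (K := e '' K) (f := fun y => e (f (e.symm y)))
    (hconv.linear_image (e : E →ₗ[ℝ] EuclideanSpace ℝ (Fin (Module.finrank ℝ E))))
    (hK.image e.continuous) (hne.image _)
    (e.continuous.comp_continuousOn (hf.comp e.symm.continuous.continuousOn hsymm))
    (fun y hy => ⟨_, hmaps (hsymm hy), rfl⟩)
  exact ⟨x, hx, by simpa using hfix⟩

/-- **Ky Fan's inequality** on a compact convex set in a finite-dimensional space. -/
theorem Convex.exists_forall_nonneg_of_isCompact {E : Type*} [NormedAddCommGroup E]
    [NormedSpace ℝ E] [FiniteDimensional ℝ E] {K : Set E} (hconv : Convex ℝ K)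
    (hK : IsCompact K) (hne : K.Nonempty) {F : E → E → ℝ}
    (hcont : ∀ y ∈ K, ContinuousOn (fun x => F x y) K)
    (hF : ∀ x ∈ K, ConvexOn ℝ K (F x)) (hdiag : ∀ x ∈ K, F x x = 0) :
    ∃ x ∈ K, ∀ y ∈ K, 0 ≤ F x y := by
  by_contra! hneg
  choose! y hyK hy using hneg
  have hnhds : ∀ x ∈ K, {z | F z (y x) < 0} ∈ nhdsWithin x K := fun x hx =>
    (hcont _ (hyK x hx) x hx).eventually_lt continuousWithinAt_const (hy x hx)
  obtain ⟨t, htK, hcover⟩ := hK.elim_nhdsWithin_subcover _ hnhds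
  -- The normalized `β i` weight exactly those `y i` with `F x (y i) < 0`. At a fixed point of the
  -- weighted average, Jensen gives `0 = F x x ≤` a negative average.
  let β : E → E → ℝ := fun i x => max 0 (-F x (y i))
  have hβ0 : ∀ i x, 0 ≤ β i x := fun i x => le_max_left _ _
  have hβc : ∀ i ∈ t, ContinuousOn (β i) K := fun i hi =>
    continuousOn_const.sup (hcont _ (hyK i (htK i hi))).neg
  have hex : ∀ x ∈ K, ∃ i ∈ t, 0 < β i x := by
    intro x hx
    obtain ⟨i, hi, hxi⟩ := Set.mem_iUnion₂.1 (hcover hx)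
    have : F x (y i) < 0 := hxi
    exact ⟨i, hi, lt_max_of_lt_right (by linarith)⟩
  have hS : ∀ x ∈ K, 0 < ∑ i ∈ t, β i x := fun x hx =>
    Finset.sum_pos' (fun i _ => hβ0 i x) (hex x hx)
  obtain ⟨x, hx, hfix⟩ := hconv.exists_fixedPoint_of_isCompact hK hne
    (f := fun x => ∑ i ∈ t, (β i x / ∑ j ∈ t, β j x) • y i)
    (continuousOn_finsetSum _ fun i hi =>
      ((hβc i hi).div (continuousOn_finsetSum _ hβc) fun x hx => (hS x hx).ne').smul
        continuousOn_const)
    (fun x hx => hconv.sum_mem (fun i _ => div_nonneg (hβ0 i x) (hS x hx).le)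
      (by rw [← Finset.sum_div, div_self (hS x hx).ne']) fun i hi => hyK i (htK i hi))
  have hjensen := (hF x hx).map_sum_le (t := t) (p := y)
    (w := fun i => β i x / ∑ j ∈ t, β j x) (fun i _ => div_nonneg (hβ0 i x) (hS x hx).le)
    (by rw [← Finset.sum_div, div_self (hS x hx).ne']) fun i hi => hyK i (htK i hi)
  rw [hfix, hdiag x hx] at hjensen
  have hlt : ∑ i ∈ t, (β i x / ∑ j ∈ t, β j x) • F x (y i) < 0 := by
    have hsign : ∀ i, 0 < β i x → F x (y i) < 0 := fun i hi => by
      rcases lt_max_iff.1 hi with h | h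
      · exact absurd h (lt_irrefl _)
      · linarith
    obtain ⟨i, hi, hpos⟩ := hex x hx
    refine Finset.sum_neg' (fun j _ => ?_) ⟨i, hi, ?_⟩
    · rcases (hβ0 j x).eq_or_lt with h | h
      · simp [← h]
      · exact mul_nonpos_of_nonneg_of_nonpos (div_nonneg h.le (hS x hx).le) (hsign j h).le
    · exact mul_neg_of_pos_of_neg (div_pos hpos (hS x hx)) (hsign i hpos)
  linarith

end Brouwer

/-! ### Level sets and sums of convex functions. -/

theorem LowerSemicontinuousOn.isClosed_setOf_mem_le {α : Type*} [TopologicalSpace α] {s : Set α}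
    {f : α → ℝ} (hs : IsClosed s) (hf : LowerSemicontinuousOn f s) (r : ℝ) :
    IsClosed {x | x ∈ s ∧ f x ≤ r} := by
  obtain ⟨v, hv, h⟩ := lowerSemicontinuousOn_iff_preimage_Iic.1 hf r
  have : {x | x ∈ s ∧ f x ≤ r} = s ∩ v := h
  exact this ▸ hs.inter hv

/-- If one level set of a lower semicontinuous convex function on a closed convex set is nonempty
and bounded, then all its level sets are bounded. -/
theorem ConvexOn.isBounded_setOf_mem_le {E : Type*} [NormedAddCommGroup E] [NormedSpace ℝ E]
    [FiniteDimensional ℝ E] {s : Set E} {f : E → ℝ} (hf : ConvexOn ℝ s f) (hs : IsClosed s)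
    (hlsc : LowerSemicontinuousOn f s) {ρ : ℝ} (hne : {x | x ∈ s ∧ f x ≤ ρ}.Nonempty)
    (hb : Bornology.IsBounded {x | x ∈ s ∧ f x ≤ ρ}) (σ : ℝ) :
    Bornology.IsBounded {x | x ∈ s ∧ f x ≤ σ} := by
  obtain ⟨x₀, hx₀, hx₀ρ⟩ := hne
  obtain ⟨R₀, hR₀⟩ := hb.subset_ball x₀
  set R := max R₀ 1
  have hR : 0 < R := lt_max_of_lt_right one_pos
  have hout : ∀ x ∈ s, R ≤ ‖x - x₀‖ → ρ < f x := by
    intro x hx hxR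
    by_contra! h
    have := hR₀ ⟨hx, h⟩
    rw [mem_ball_iff_norm] at this
    exact absurd (this.trans_le (le_max_left _ _)) (not_lt.2 hxR)
  -- Lower semicontinuity yields a minimum above `ρ` on the sphere of radius `R`; if the sphere
  -- misses `s`, any `c > ρ` serves. By convexity `f` then grows outside with slope at least `(c - f
  -- x₀) / R`, which dictates the radius below.
  obtain ⟨c, hc, hcmin⟩ : ∃ c, ρ < c ∧ ∀ x ∈ s, ‖x - x₀‖ = R → c ≤ f x := by
    have hcomp : IsCompact (s ∩ Metric.sphere x₀ R) := (isCompact_sphere x₀ R).inter_left hs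
    rcases (s ∩ Metric.sphere x₀ R).eq_empty_or_nonempty with h | h
    · refine ⟨ρ + 1, by linarith, fun x hx hxR => ?_⟩
      have : x ∈ s ∩ Metric.sphere x₀ R := ⟨hx, mem_sphere_iff_norm.2 hxR⟩
      simp [h] at this
    · obtain ⟨a, ha, hmin⟩ := LowerSemicontinuousOn.exists_isMinOn h hcomp
        (hlsc.mono Set.inter_subset_left)
      exact ⟨f a, hout a ha.1 (mem_sphere_iff_norm.1 ha.2).ge, fun x hx hxR =>
        hmin ⟨hx, mem_sphere_iff_norm.2 hxR⟩⟩
  have hc0 : 0 < c - f x₀ := by linarith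
  refine (Metric.isBounded_iff_subset_closedBall x₀).2 ⟨max R (R * (σ - f x₀) / (c - f x₀)), ?_⟩
  rintro x ⟨hx, hxσ⟩
  rw [mem_closedBall_iff_norm]
  rcases le_total ‖x - x₀‖ R with h | h
  · exact h.trans (le_max_left _ _)
  · refine le_trans ?_ (le_max_right _ _)
    have hd : 0 < ‖x - x₀‖ := hR.trans_le h
    set a := R / ‖x - x₀‖ with ha
    have ha0 : 0 ≤ a := by positivity
    have ha1 : a ≤ 1 := (div_le_one hd).2 h
    have hmem : (1 - a) • x₀ + a • x ∈ s := hf.1 hx₀ hx (by linarith) ha0 (by ring)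
    have h1 : c ≤ f ((1 - a) • x₀ + a • x) := by
      refine hcmin _ hmem ?_
      rw [show (1 - a) • x₀ + a • x - x₀ = a • (x - x₀) by module, norm_smul,
        Real.norm_of_nonneg ha0, ha, div_mul_cancel₀ _ hd.ne']
    have h2 := hf.2 hx₀ hx (sub_nonneg.2 ha1) ha0 (by ring)
    simp only [smul_eq_mul] at h2
    have h3 : c - f x₀ ≤ a * (σ - f x₀) := by nlinarith
    rw [ha, div_mul_eq_mul_div, le_div_iff₀ hd] at h3
    rw [le_div_iff₀ hc0]
    linarith

theorem convexOn_finsetSum {ι E : Type*} [AddCommGroup E] [Module ℝ E] {s : Set E}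
    (hs : Convex ℝ s) (t : Finset ι) {f : ι → E → ℝ} (hf : ∀ i ∈ t, ConvexOn ℝ s (f i)) :
    ConvexOn ℝ s fun x => ∑ i ∈ t, f i x := by
  classical
  induction t using Finset.induction_on with
  | empty => simpa using convexOn_const 0 hs
  | insert i t hi ih =>
    simp only [Finset.sum_insert hi]
    exact (hf i (by simp)).add (ih fun j hj => hf j (by simp [hj]))

theorem IsPenaltyKernel.nonneg {m : ℕ} {φ : (Fin m → ℝ) → ℝ} (hφ : IsPenaltyKernel φ)
    (v : Fin m → ℝ) : 0 ≤ φ v := by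
  by_cases h : v ≤ 0
  · exact (hφ.eq_zero _ h).ge
  · exact (hφ.pos _ h).le

/-! ### The penalized game: existence, localization and limit points. -/

namespace JointGame

variable {l m : ℕ} {n : Fin l → ℕ} {G : JointGame l m n}

theorem update_mem_prodX {x y : Profile n} (hx : x ∈ G.prodX) (hy : y ∈ G.prodX) (i : Fin l) :
    Function.update x i (y i) ∈ G.prodX := by
  intro j
  rcases eq_or_ne j i with rfl | h
  · simpa using hy j
  · simpa [h] using hx j

theorem Phi_self (x : Profile n) : G.Phi x x = 0 := sub_self _

namespace BasicAssumptions

theorem convex_prodX (hG : G.BasicAssumptions) : Convex ℝ G.prodX := fun _ hx _ hy _ _ ha hb hab i =>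
  hG.convex_X i (hx i) (hy i) ha hb hab

theorem isClosed_prodX (hG : G.BasicAssumptions) : IsClosed G.prodX := by
  have : G.prodX = ⋂ i, (fun x : Profile n => x i) ⁻¹' G.X i := by
    ext x; simp [prodX]
  rw [this]
  exact isClosed_iInter fun i => (hG.closed_X i).preimage (continuous_apply i)

theorem continuousOn_Phi (hG : G.BasicAssumptions) {y : Profile n} (hy : y ∈ G.prodX) :
    ContinuousOn (fun x => G.Phi x y) G.prodX := by
  refine ContinuousOn.sub ?_ ?_
  · simp only [Psi, Function.update_eq_self]
    exact continuousOn_finsetSum _ fun i _ => hG.continuous_f i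
  · refine continuousOn_finsetSum _ fun i _ => (hG.continuous_f i).comp ?_
      fun x hx => update_mem_prodX hx hy i
    exact (continuous_id.update i continuous_const).continuousOn

theorem convexOn_Phi (hG : G.BasicAssumptions) {x : Profile n} (hx : x ∈ G.prodX) :
    ConvexOn ℝ G.prodX (G.Phi x) := by
  have h : ConvexOn ℝ G.prodX fun y => ∑ i, -G.f i (Function.update x i (y i)) :=
    convexOn_finsetSum hG.convex_prodX _ fun i _ =>
      (((hG.concave_f i x hx).comp_linearMap
        (LinearMap.proj (φ := fun i => Fin (n i) → ℝ) i)).subset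
        (fun y (hy : y ∈ G.prodX) => hy i) hG.convex_prodX).neg
  refine (h.add_const (G.Psi x x)).congr fun y _ => ?_
  simp [Phi, Psi, Finset.sum_neg_distrib]
  ring

theorem continuous_h (hG : G.BasicAssumptions) (i : Fin l) : Continuous (G.h i) :=
  continuous_pi fun j => (hG.convex_h i j).locallyLipschitz.continuous

theorem continuous_penalty (hG : G.BasicAssumptions) {φ : (Fin m → ℝ) → ℝ} (hφ : IsPenaltyKernel φ) :
    Continuous (G.penalty φ) := by
  refine continuous_finsetSum _ fun i _ => hφ.differentiable.continuous.comp ?_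
  exact ((hG.continuous_h i).comp ((continuous_apply i).comp continuous_fst)).sub
    ((continuous_apply i).comp continuous_snd)

/-- Isotonicity of `φ` is what lets its convexity survive composition with the componentwise convex
`h i (x i) - u i`. -/
theorem convexOn_penalty (hG : G.BasicAssumptions) {φ : (Fin m → ℝ) → ℝ} (hφ : IsPenaltyKernel φ) :
    ConvexOn ℝ Set.univ (G.penalty φ) := by
  refine convexOn_finsetSum convex_univ _ fun i _ => ⟨convex_univ, ?_⟩
  rintro ⟨x, u⟩ - ⟨y, v⟩ - a b ha hb hab
  refine le_trans (hφ.isotone ?_)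
    (hφ.convex.2 (Set.mem_univ (G.h i (x i) - u i)) (Set.mem_univ (G.h i (y i) - v i)) ha hb hab)
  intro j
  have := (hG.convex_h i j).2 (Set.mem_univ (x i)) (Set.mem_univ (y i)) ha hb hab
  simp at this ⊢
  linarith

end BasicAssumptions

theorem penalty_nonneg {φ : (Fin m → ℝ) → ℝ} (hφ : IsPenaltyKernel φ)
    (w : Profile n × Shares l m) : 0 ≤ G.penalty φ w :=
  Finset.sum_nonneg fun _ _ => hφ.nonneg _

theorem penalty_eq_zero_iff {φ : (Fin m → ℝ) → ℝ} (hφ : IsPenaltyKernel φ)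
    (w : Profile n × Shares l m) : G.penalty φ w = 0 ↔ ∀ i, G.h i (w.1 i) ≤ w.2 i := by
  refine ⟨fun h i => ?_, fun h => Finset.sum_eq_zero fun i _ => hφ.eq_zero _ (sub_nonpos.2 (h i))⟩
  by_contra hi
  have h0 := (Finset.sum_eq_zero_iff_of_nonneg fun _ _ => hφ.nonneg _).1 h i (Finset.mem_univ i)
  exact (hφ.pos _ fun h' => hi (sub_nonpos.1 h')).ne' h0

theorem AdmissibleShares.exists_penalty_eq_zero {U₀ : Set (Shares l m)}
    (hU : G.AdmissibleShares U₀) {φ : (Fin m → ℝ) → ℝ} (hφ : IsPenaltyKernel φ)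
    {x : Profile n} (hx : x ∈ G.feasible) : ∃ u ∈ G.shareSet U₀, G.penalty φ (x, u) = 0 := by
  obtain ⟨u, hu, h⟩ := hU.covers x hx
  exact ⟨u, hu, (penalty_eq_zero_iff hφ _).2 h⟩

theorem BasicAssumptions.convexOn_penPhi (hG : G.BasicAssumptions) {φ : (Fin m → ℝ) → ℝ}
    (hφ : IsPenaltyKernel φ) {t : ℝ} (ht : 0 ≤ t) {w : Profile n × Shares l m}
    (hw : w.1 ∈ G.prodX) : ConvexOn ℝ (G.prodX ×ˢ Set.univ) (G.penPhi φ t w) := by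
  have hconv : Convex ℝ (G.prodX ×ˢ (Set.univ : Set (Shares l m))) :=
    hG.convex_prodX.prod convex_univ
  have h1 : ConvexOn ℝ (G.prodX ×ˢ (Set.univ : Set (Shares l m))) fun w' => G.Phi w.1 w'.1 :=
    ((hG.convexOn_Phi hw).comp_linearMap
      (LinearMap.fst ℝ (Profile n) (Shares l m))).subset (fun w' hw' => hw'.1) hconv
  have h2 := (((hG.convexOn_penalty hφ).subset (Set.subset_univ _) hconv).smul ht).add_const
    (-(t * G.penalty φ w))
  refine (h1.add h2).congr fun w' _ => ?_
  simp [penPhi]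
  ring

theorem BasicAssumptions.isCompact_levelSet (hG : G.BasicAssumptions) {μ : Profile n → ℝ}
    {r : ℝ} (hC : G.Coercivity μ r) (ρ : ℝ) : IsCompact (G.levelSet μ ρ) := by
  obtain ⟨ρ₀, hne, hb⟩ := hC.weaklyCoercive
  exact Metric.isCompact_of_isClosed_isBounded
    (hC.lsc.isClosed_setOf_mem_le hG.isClosed_prodX ρ)
    (hC.convex.isBounded_setOf_mem_le hG.isClosed_prodX hC.lsc hne hb ρ)

/-- Outside `B_r` the descent point, with shares of zero penalty, makes `penPhi` negative. Only
competitors with `μ ≤ μ w.1` are tested, so the lemma serves both the truncated and the full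
problem. -/
theorem mem_levelSet_of_forall_penPhi_nonneg {μ : Profile n → ℝ} {r : ℝ}
    (hC : G.Coercivity μ r) {U₀ : Set (Shares l m)} (hU : G.AdmissibleShares U₀)
    {φ : (Fin m → ℝ) → ℝ} (hφ : IsPenaltyKernel φ) {t : ℝ} (ht : 0 < t)
    {w : Profile n × Shares l m} (hw : w.1 ∈ G.prodX)
    (h : ∀ w' ∈ G.levelSet μ (μ w.1) ×ˢ G.shareSet U₀, 0 ≤ G.penPhi φ t w w') :
    w.1 ∈ G.levelSet μ r := by
  by_contra hn
  obtain ⟨z, hz, hμ, hneg⟩ := hC.descent w.1 ⟨hw, hn⟩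
  obtain ⟨v, hv, h0⟩ := hU.exists_penalty_eq_zero hφ hz
  have := h (z, v) ⟨⟨hz.1, hμ⟩, hv⟩
  simp only [penPhi, h0] at this
  have := mul_nonneg ht.le (penalty_nonneg (G := G) hφ w)
  linarith

theorem BasicAssumptions.exists_isPenalizedSolution (hG : G.BasicAssumptions)
    {μ : Profile n → ℝ} {r : ℝ} (hC : G.Coercivity μ r) {U₀ : Set (Shares l m)}
    (hU : G.AdmissibleShares U₀) (hUb : Bornology.IsBounded (G.shareSet U₀))
    {φ : (Fin m → ℝ) → ℝ} (hφ : IsPenaltyKernel φ) {t : ℝ} (ht : 0 < t) :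
    ∃ w, G.IsPenalizedSolution U₀ φ t w := by
  obtain ⟨x₀, hx₀⟩ := hG.feasible_nonempty
  obtain ⟨u₀, hu₀, -⟩ := hU.covers x₀ hx₀
  -- The first entry makes the truncated set nonempty, the second puts `ρ` strictly above `r`.
  set ρ := max (μ x₀) (r + 1)
  have hrρ : r < ρ := lt_max_of_lt_right (by linarith)
  set K := G.levelSet μ ρ ×ˢ G.shareSet U₀
  have hKX : ∀ w ∈ K, w.1 ∈ G.prodX := fun w hw => hw.1.1
  have hKconv : Convex ℝ K := (hC.convex.convex_le ρ).prod hU.convex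
  have hKcomp : IsCompact K := (hG.isCompact_levelSet hC ρ).prod
    (Metric.isCompact_of_isClosed_isBounded hU.closed hUb)
  obtain ⟨w, hw, hsol⟩ := hKconv.exists_forall_nonneg_of_isCompact hKcomp
    ⟨(x₀, u₀), ⟨hx₀.1, le_max_left _ _⟩, hu₀⟩ (F := G.penPhi φ t)
    (fun w' hw' => ((hG.continuousOn_Phi (hKX w' hw')).comp continuousOn_fst hKX).add
      (continuous_const.mul
        (continuous_const.sub (hG.continuous_penalty hφ))).continuousOn)
    (fun w hw => (hG.convexOn_penPhi hφ ht.le (hKX w hw)).subset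
      (fun w' hw' => ⟨hKX w' hw', Set.mem_univ _⟩) hKconv)
    (fun w _ => by simp [penPhi, Phi_self])
  have hwr : w.1 ∈ G.levelSet μ r :=
    mem_levelSet_of_forall_penPhi_nonneg hC hU hφ ht (hKX w hw) fun w' hw' =>
      hsol w' ⟨⟨hw'.1.1, hw'.1.2.trans hw.1.2⟩, hw'.2⟩
  have hwρ : μ w.1 < ρ := hwr.2.trans_lt hrρ
  refine ⟨w, ⟨hwr.1, hw.2⟩, fun w' hw' => ?_⟩
  -- As `μ w.1 < ρ`, a short move from `w` towards any `w'` stays in `K`. Convexity and `penPhi w w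
  -- = 0` then carry the inequality to `w'`.
  obtain ⟨a, ha0, ha1, haρ⟩ : ∃ a : ℝ, 0 < a ∧ a ≤ 1 ∧ (1 - a) * μ w.1 + a * μ w'.1 ≤ ρ := by
    have hlim : Filter.Tendsto (fun a : ℝ => (1 - a) * μ w.1 + a * μ w'.1)
        (nhdsWithin 0 (Set.Ioi 0)) (nhds ((1 - 0) * μ w.1 + 0 * μ w'.1)) :=
      ((by fun_prop : Continuous fun a : ℝ => (1 - a) * μ w.1 + a * μ w'.1).tendsto 0).mono_left
        nhdsWithin_le_nhds
    have hev := hlim.eventually_lt_const (u := ρ) (by simpa using hwρ)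
    obtain ⟨a, h1, h2⟩ := (hev.and (Ioc_mem_nhdsGT (zero_lt_one' ℝ))).exists
    exact ⟨a, h2.1, h2.2, h1.le⟩
  have hmem : (1 - a) • w + a • w' ∈ K := by
    have hX : (1 - a) • w.1 + a • w'.1 ∈ G.prodX :=
      hG.convex_prodX hwr.1 hw'.1 (by linarith) ha0.le (by ring)
    exact ⟨⟨hX, (hC.convex.2 hwr.1 hw'.1 (by linarith) ha0.le (by ring)).trans haρ⟩,
      hU.convex hw.2 hw'.2 (by linarith) ha0.le (by ring)⟩
  have h1 := hsol _ hmem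
  have h2 := (hG.convexOn_penPhi hφ ht.le (hKX w hw)).2 (x := w) (y := w')
    ⟨hwr.1, Set.mem_univ _⟩ ⟨hw'.1, Set.mem_univ _⟩ (sub_nonneg.2 ha1) ha0.le (by ring)
  have h3 : G.penPhi φ t w w = 0 := by simp [penPhi, Phi_self]
  rw [h3, smul_zero, zero_add, smul_eq_mul] at h2
  exact nonneg_of_mul_nonneg_right (h1.trans h2) ha0

theorem IsPenalizedSolution.mem_levelSet_prod {μ : Profile n → ℝ} {r : ℝ}
    (hC : G.Coercivity μ r) {U₀ : Set (Shares l m)} (hU : G.AdmissibleShares U₀)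
    {φ : (Fin m → ℝ) → ℝ} (hφ : IsPenaltyKernel φ) {t : ℝ} (ht : 0 < t)
    {w : Profile n × Shares l m} (hw : G.IsPenalizedSolution U₀ φ t w) :
    w ∈ G.levelSet μ r ×ˢ G.shareSet U₀ :=
  ⟨mem_levelSet_of_forall_penPhi_nonneg hC hU hφ ht hw.1.1 fun w' hw' =>
    hw.2 w' ⟨hw'.1.1, hw'.2⟩, hw.1.2⟩

theorem IsPenalizedSolution.penalty_le_Phi {U₀ : Set (Shares l m)} (hU : G.AdmissibleShares U₀)
    {φ : (Fin m → ℝ) → ℝ} (hφ : IsPenaltyKernel φ) {t : ℝ}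
    {w : Profile n × Shares l m} (hw : G.IsPenalizedSolution U₀ φ t w) {y : Profile n}
    (hy : y ∈ G.feasible) : t * G.penalty φ w ≤ G.Phi w.1 y := by
  obtain ⟨v, hv, h0⟩ := hU.exists_penalty_eq_zero hφ hy
  have := hw.2 (y, v) ⟨hy.1, hv⟩
  simp only [penPhi, h0] at this
  linarith

theorem BasicAssumptions.mapClusterPt_isPenalizedSolution (hG : G.BasicAssumptions)
    {μ : Profile n → ℝ} {r : ℝ} (hC : G.Coercivity μ r) {U₀ : Set (Shares l m)}
    (hU : G.AdmissibleShares U₀) {φ : (Fin m → ℝ) → ℝ} (hφ : IsPenaltyKernel φ) {τ : ℕ → ℝ}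
    (hτpos : ∀ k, 0 < τ k) (hτ : Filter.Tendsto τ Filter.atTop Filter.atTop)
    {w : ℕ → Profile n × Shares l m} (hw : ∀ k, G.IsPenalizedSolution U₀ φ (τ k) (w k))
    {w' : Profile n × Shares l m} (hw' : MapClusterPt w' Filter.atTop w) :
    w' ∈ (G.levelSet μ r ∩ G.feasible) ×ˢ G.shareSet U₀ ∧ G.IsNormalizedEquilibrium w'.1 := by
  obtain ⟨ψ, hψ, hlim⟩ := hw'.tendsto_subseq
  have hmem : ∀ k, w k ∈ G.levelSet μ r ×ˢ G.shareSet U₀ := fun k =>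
    (hw k).mem_levelSet_prod hC hU hφ (hτpos k)
  have hw'm : w' ∈ G.levelSet μ r ×ˢ G.shareSet U₀ :=
    ((hG.isCompact_levelSet hC r).isClosed.prod hU.closed).mem_of_tendsto hlim
      (Filter.Eventually.of_forall fun k => hmem (ψ k))
  have hPhi : ∀ y ∈ G.feasible, Filter.Tendsto (fun k => G.Phi (w (ψ k)).1 y) Filter.atTop
      (nhds (G.Phi w'.1 y)) := fun y hy =>
    (hG.continuousOn_Phi hy.1 w'.1 hw'm.1.1).tendsto.comp
      (tendsto_nhdsWithin_iff.2 ⟨(continuous_fst.tendsto w').comp hlim,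
        Filter.Eventually.of_forall fun k => (hmem (ψ k)).1.1⟩)
  -- Otherwise `τ P` would tend to infinity below the convergent `Φ(·, y)`.
  have hpen : G.penalty φ w' = 0 := by
    by_contra hne
    have hpos : 0 < G.penalty φ w' := lt_of_le_of_ne (penalty_nonneg hφ w') (Ne.symm hne)
    obtain ⟨y, hy⟩ := hG.feasible_nonempty
    have h1 : Filter.Tendsto (fun k => τ (ψ k) * G.penalty φ (w (ψ k))) Filter.atTop
        Filter.atTop :=
      (hτ.comp hψ.tendsto_atTop).atTop_mul_pos hpos
        (((hG.continuous_penalty hφ).tendsto w').comp hlim)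
    exact not_tendsto_nhds_of_tendsto_atTop
      (Filter.tendsto_atTop_mono (fun k => (hw (ψ k)).penalty_le_Phi hU hφ hy) h1) _ (hPhi y hy)
  have hfeas : w'.1 ∈ G.feasible := by
    refine ⟨hw'm.1.1, ?_⟩
    change ∑ i, G.h i (w'.1 i) ≤ G.b
    rw [← hw'm.2.2]
    exact Finset.sum_le_sum fun i _ => (penalty_eq_zero_iff hφ w').1 hpen i
  refine ⟨⟨⟨hw'm.1, hfeas⟩, hw'm.2⟩, hfeas, fun y hy => ?_⟩
  exact ge_of_tendsto' (hPhi y hy) fun k =>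
    (mul_nonneg (hτpos _).le (penalty_nonneg hφ _)).trans ((hw (ψ k)).penalty_le_Phi hU hφ hy)

end JointGame

theorem theorem4p1 {l m : ℕ} {n : Fin l → ℕ} (G : JointGame l m n)
    (hA1 : G.BasicAssumptions)
    (μ : Profile n → ℝ) (r : ℝ) (hC5 : G.Coercivity μ r)
    (U₀ : Set (Shares l m)) (hU : G.AdmissibleShares U₀)
    (hUb : Bornology.IsBounded (G.shareSet U₀))
    (φ : (Fin m → ℝ) → ℝ) (hφ : IsPenaltyKernel φ)
    (τ : ℕ → ℝ) (hτpos : ∀ k, 0 < τ k) (hτmono : Monotone τ)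
    (hτ : Filter.Tendsto τ Filter.atTop Filter.atTop) :
    (∃ x, G.IsNormalizedEquilibrium x) ∧
    (∀ t : ℝ, 0 < t →
      (∃ w, G.IsPenalizedSolution U₀ φ t w) ∧
      ∀ w, G.IsPenalizedSolution U₀ φ t w → w ∈ G.levelSet μ r ×ˢ G.shareSet U₀) ∧
    (∀ w : ℕ → Profile n × Shares l m, (∀ k, G.IsPenalizedSolution U₀ φ (τ k) (w k)) →
      (∃ w', MapClusterPt w' Filter.atTop w) ∧
      ∀ w', MapClusterPt w' Filter.atTop w →
        w' ∈ (G.levelSet μ r ∩ G.feasible) ×ˢ G.shareSet U₀ ∧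
        G.IsNormalizedEquilibrium w'.1) := by
  have hex : ∀ t : ℝ, 0 < t → ∃ w, G.IsPenalizedSolution U₀ φ t w := fun t ht =>
    hA1.exists_isPenalizedSolution hC5 hU hUb hφ ht
  have hcluster : ∀ w : ℕ → Profile n × Shares l m,
      (∀ k, G.IsPenalizedSolution U₀ φ (τ k) (w k)) → ∃ w', MapClusterPt w' Filter.atTop w := by
    intro w hw
    have hcomp : IsCompact (G.levelSet μ r ×ˢ G.shareSet U₀) :=
      (hA1.isCompact_levelSet hC5 r).prod (Metric.isCompact_of_isClosed_isBounded hU.closed hUb)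
    obtain ⟨w', -, ψ, hψ, hlim⟩ := hcomp.tendsto_subseq fun k =>
      (hw k).mem_levelSet_prod hC5 hU hφ (hτpos k)
    exact ⟨w', MapClusterPt.of_comp hψ.tendsto_atTop hlim.mapClusterPt⟩
  refine ⟨?_, fun t ht => ⟨hex t ht, fun w hw => hw.mem_levelSet_prod hC5 hU hφ ht⟩,
    fun w hw => ⟨hcluster w hw, fun w' hw' =>
      hA1.mapClusterPt_isPenalizedSolution hC5 hU hφ hτpos hτ hw hw'⟩⟩
  choose w hw using fun k => hex (τ k) (hτpos k)
  obtain ⟨w', hw'⟩ := hcluster w hw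
  exact ⟨w'.1, (hA1.mapClusterPt_isPenalizedSolution hC5 hU hφ hτpos hτ hw hw').2⟩
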